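/- A hypergraph on a finite vertex set $V$ has as its edges a multiset of subsets of $V$, each with at least two elements (multiple edges are allowed). A walk is a sequence $v_0,e_1,v_1,\dots,e_m,v_m$ of vertices $v_i$ and edges $e_i$ with $\{v_{i-1},v_i\}\subseteq e_i$ for all $i$. It is a path if all its vertices are distinct and all its edges are distinct. It is a cycle if $m\ge 2$, all its edges are distinct, and all its vertices are distinct except that $v_0=v_m$. A hypertree is a hypergraph that has no cycles and in which any two vertices are joined by a path. For $n\ge 1$ and a finitely supported sequence $\lambda=(\lambda_2,\lambda_3,\dots)$ of nonnegative integers, let $\tau_{n,\lambda}$ be the number of labeled hypertrees with $n$ vertices, labeled by $1,\dots,n$, and with exactly $\lambda_j$ edges of size $j$, labeled by $1,\dots,\lambda_j$, for each $j\ge 2$. Let $t,u_2,u_3,\dots$ be indeterminates and let $$T=\sum_{n\ge 1}\frac{t^n}{n!}\sum_{\lambda}\tau_{n,\lambda}\prod_{j\ge 2}\frac{u_j^{\lambda_j}}{\lambda_j!}$$ be the exponential generating function of hypertrees, a formal power series over $\mathbb{Q}$. Put $R=t\,\dfrac{\partial T}{\partial t}$. Then the series $\sum_{j\ge 2}(j-1)\,u_j\,\dfrac{R^j}{j!}$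 converges in the ring of formal power series (with coefficientwise convergence, $\mathbb{Q}$ being discrete), and $$T=R-\sum_{j=2}^{\infty}(j-1)\,u_j\,\frac{R^j}{j!}.$$ -/

import Mathlib

open scoped Nat MvPowerSeries.WithPiTopology

/-- A hypergraph with vertex set `V` and edges named by `E`: each edge is a set of at least two
vertices, and differently named edges may have the same set of vertices (multiple edges). -/
@[ext]
structure MultiHypergraph (V E : Type*) where
  /-- the set of vertices of an edge -/
  ends : E → Finset V
  two_le_card : ∀ e, 2 ≤ (ends e).card

namespace MultiHypergraph

/-- `v 0, e 0, v 1, …, e (m - 1), v m` is a walk: each edge contains the vertices next to it. -/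
def IsWalk {V E : Type*} (H : MultiHypergraph V E) {m : ℕ}
    (v : Fin (m + 1) → V) (e : Fin m → E) : Prop :=
  ∀ i : Fin m, v i.castSucc ∈ H.ends (e i) ∧ v i.succ ∈ H.ends (e i)

/-- A path is a walk with distinct vertices and distinct edges. -/
def IsPath {V E : Type*} (H : MultiHypergraph V E) {m : ℕ}
    (v : Fin (m + 1) → V) (e : Fin m → E) : Prop :=
  H.IsWalk v e ∧ Function.Injective v ∧ Function.Injective e

/-- A cycle is a walk with at least two edges, in which all edges are distinct, and all vertices
are distinct except that the last one is the first one. -/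
def IsCycle {V E : Type*} (H : MultiHypergraph V E) {m : ℕ}
    (v : Fin (m + 1) → V) (e : Fin m → E) : Prop :=
  H.IsWalk v e ∧ 2 ≤ m ∧ Function.Injective e ∧
    Function.Injective (fun i : Fin m => v i.castSucc) ∧ v (Fin.last m) = v 0

/-- Any two vertices are joined by a path. -/
def IsConnected {V E : Type*} (H : MultiHypergraph V E) : Prop :=
  ∀ a b : V, ∃ (m : ℕ) (v : Fin (m + 1) → V) (e : Fin m → E),
    H.IsPath v e ∧ v 0 = a ∧ v (Fin.last m) = b

/-- A hypertree is a connected hypergraph without cycles. -/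
def IsHypertree {V E : Type*} (H : MultiHypergraph V E) : Prop :=
  H.IsConnected ∧
    ¬ ∃ (m : ℕ) (v : Fin (m + 1) → V) (e : Fin m → E), H.IsCycle v e

instance {V E : Type*} [Finite V] [Finite E] : Finite (MultiHypergraph V E) :=
  Finite.of_injective (fun H : MultiHypergraph V E => H.ends) fun _ _ h => MultiHypergraph.ext h

end MultiHypergraph

/-- The possible sizes `j ≥ 2` of an edge. -/
abbrev EdgeSize : Type := {j : ℕ // 2 ≤ j}

/-- The edge labels of a labeled hypergraph with `lam j` edges of size `j` for each `j`:
the label `⟨j, k⟩` is that of the `k`-th `j`-edge. -/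
abbrev EdgeLabel (lam : EdgeSize →₀ ℕ) : Type := Σ j : EdgeSize, Fin (lam j)

/-- There are only finitely many edge labels, so that the counts below are counts of finite
sets. -/
instance (lam : EdgeSize →₀ ℕ) : Finite (EdgeLabel lam) := by
  refine Finite.of_injective (β := Σ j : lam.support, Fin (lam j))
    (fun e => ⟨⟨e.1, Finsupp.mem_support_iff.2 fun h => (Fin.cast h e.2).elim0⟩, e.2⟩) ?_
  rintro ⟨j, k⟩ ⟨j', k'⟩ h
  simp only [Sigma.mk.injEq, Subtype.mk.injEq] at h
  obtain ⟨rfl, h⟩ := h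
  simpa using h

/-- The number of labeled hypertrees with `n` labeled vertices and, for each `j`,
exactly `lam j` edges of size `j`, labeled by `Fin (lam j)`. -/
noncomputable def hypertreeCount (n : ℕ) (lam : EdgeSize →₀ ℕ) : ℕ :=
  Nat.card {H : MultiHypergraph (Fin n) (EdgeLabel lam) //
    (∀ e : EdgeLabel lam, (H.ends e).card = e.1) ∧ H.IsHypertree}

/-- Formal power series over `ℚ` in the indeterminates `t` and `u j` for `j ≥ 2`;
`none` is the index of `t`, and `some j` that of `u j`. -/
abbrev HypergraphSeries : Type := MvPowerSeries (Option EdgeSize) ℚ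

namespace HypergraphSeries

/-- The indeterminate `t` marking vertices. -/
noncomputable def t : HypergraphSeries := MvPowerSeries.X none

/-- The indeterminate `u j` marking edges of size `j`. -/
noncomputable def u (j : EdgeSize) : HypergraphSeries := MvPowerSeries.X (some j)

/-- The partial derivative with respect to `t`. -/
noncomputable def dt (F : HypergraphSeries) : HypergraphSeries := MvPowerSeries.pderiv ℚ none F

/-- The exponential generating function `T` of hypertrees: for `n ≥ 1`, the coefficient of
`(t ^ n / n!) * ∏ j, (u j) ^ lam j / (lam j)!` is the number of labeled hypertrees with `n`
vertices and `lam j` edges of size `j` for all `j`. The monomials without `t` do not occur. -/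
noncomputable def hypertreeEGF : HypergraphSeries := fun d =>
  if d none = 0 then 0
  else (hypertreeCount (d none) d.some : ℚ) / ((d none)! * d.some.prod fun _ k => (k ! : ℚ))

end HypergraphSeries

/-!
Count hypertrees whose vertices and edges are both labeled. Deleting an edge of size `j` from a
hypertree splits it into `j` hypertrees, each with a distinguished vertex, namely its vertex on
that edge; conversely, `j` rooted hypertrees are joined by an edge through their roots. Hence
`R ^ j / j! = ∂T/∂u_j`. On the other hand the vertex-edge incidence graph of a hypertree is a tree,
so a hypertree with `n` vertices and `λ_j` edges of size `j` satisfies `n - ∑ (j - 1) λ_j = 1`,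
which coefficientwise says `t ∂T/∂t - ∑ (j - 1) u_j ∂T/∂u_j = T`.
-/

theorem reachable_of_forall_adj_reachable {V W : Type*} {G : SimpleGraph V} {G' : SimpleGraph W}
    (f : V → W) (hf : ∀ x y, G.Adj x y → G'.Reachable (f x) (f y)) {x y : V}
    (h : G.Reachable x y) : G'.Reachable (f x) (f y) := by
  simp only [SimpleGraph.reachable_iff_reflTransGen] at hf h ⊢
  exact h.lift' f hf

theorem eq_of_reachable_of_forall_adj_eq {V α : Type*} {G : SimpleGraph V} {f : V → α}
    (hf : ∀ x y, G.Adj x y → f x = f y) {x y : V} (h : G.Reachable x y) : f x = f y :=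
  SimpleGraph.reachable_bot.1 <|
    reachable_of_forall_adj_reachable f (fun x y hxy => SimpleGraph.reachable_bot.2 (hf x y hxy)) h

section Branches

variable {W ι : Type*} {G : SimpleGraph (Option W)} {r : ι → W} {c : W → ι}

/-- The neighbours of the vertex `none` are the `r i`, and `c` is a colouring of the other
vertices that gives `r i` the colour `i` and is constant along the edges that avoid `none`.
In a tree, the vertices of colour `i` thus form the branch at `none` that contains `r i`. -/
structure IsBranchColoring (G : SimpleGraph (Option W)) (r : ι → W) (c : W → ι) : Prop where
  adj_none_iff : ∀ w, G.Adj none (some w) ↔ w ∈ Set.range r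
  color_root : ∀ i, c (r i) = i
  color_eq_of_adj : ∀ v w, G.Adj (some v) (some w) → c v = c w

/-- The subgraph of `G` on the vertices of colour `i`. -/
def branch (G : SimpleGraph (Option W)) (c : W → ι) (i : ι) : SimpleGraph {w // c w = i} :=
  G.comap fun w => some w.1

theorem exists_reachable_root (hG : G.Connected)
    (hr : ∀ w, G.Adj none (some w) ↔ w ∈ Set.range r) (w : W) :
    ∃ i, (G.comap some).Reachable (r i) w := by
  let P : Option W → Prop := fun x => ∀ w, x = some w → ∃ i, (G.comap some).Reachable (r i) w
  have hP {x : Option W} (h : Relation.ReflTransGen G.Adj none x) : P x := by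
    induction h with
    | refl => rintro w ⟨⟩
    | @tail y z _ hyz ih =>
      rintro w rfl
      cases y with
      | none =>
        obtain ⟨i, rfl⟩ := (hr w).1 hyz
        exact ⟨i, .refl _⟩
      | some v => exact (ih v rfl).imp fun i hi =>
          hi.trans (SimpleGraph.Adj.reachable (G := G.comap some) hyz)
  exact hP ((SimpleGraph.reachable_iff_reflTransGen _ _).1 (hG.preconnected none (some w))) w rfl

theorem eq_of_reachable_root (hG : G.IsAcyclic)
    (hr : ∀ w, G.Adj none (some w) ↔ w ∈ Set.range r) (hinj : Function.Injective r) {i k : ι}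
    (h : (G.comap some).Reachable (r i) (r k)) : i = k := by
  by_contra hik
  have hbridge : G.IsBridge s(none, some (r i)) :=
    SimpleGraph.isAcyclic_iff_forall_adj_isBridge.1 hG ((hr _).2 ⟨i, rfl⟩)
  rw [SimpleGraph.isBridge_iff] at hbridge
  refine hbridge (.trans (v := some (r k)) (SimpleGraph.Adj.reachable ?_)
    (reachable_of_forall_adj_reachable some (fun v w hvw => SimpleGraph.Adj.reachable ?_) h.symm))
  · exact SimpleGraph.deleteEdges_adj.2 ⟨(hr _).2 ⟨k, rfl⟩, by simpa using hinj.ne (Ne.symm hik)⟩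
  · exact SimpleGraph.deleteEdges_adj.2 ⟨hvw, by simp⟩

namespace IsBranchColoring

theorem color_eq_of_reachable (hc : IsBranchColoring G r c) {v w : W}
    (h : (G.comap some).Reachable v w) : c v = c w :=
  eq_of_reachable_of_forall_adj_eq hc.color_eq_of_adj h

theorem existsUnique (hG : G.IsTree) (hr : ∀ w, G.Adj none (some w) ↔ w ∈ Set.range r)
    (hinj : Function.Injective r) : ∃! c, IsBranchColoring G r c := by
  choose c hc using exists_reachable_root hG.connected hr
  have color_eq_of_reachable {v w : W} (h : (G.comap some).Reachable v w) : c v = c w :=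
    eq_of_reachable_root hG.isAcyclic hr hinj ((hc v).trans (h.trans (hc w).symm))
  refine ⟨c, ⟨hr, fun i => ?_, fun v w hvw => ?_⟩, fun c' hc' => funext fun w => ?_⟩
  · exact eq_of_reachable_root hG.isAcyclic hr hinj (hc _)
  · exact color_eq_of_reachable (SimpleGraph.Adj.reachable (G := G.comap some) hvw)
  · rw [← hc'.color_eq_of_reachable (hc w), hc'.color_root]

open Classical in
/-- The retraction of a graph onto a branch that contracts everything else to its root. -/
noncomputable def retract (hc : IsBranchColoring G r c) (i : ι) : Option W → {w // c w = i}
  | none => ⟨r i, hc.color_root i⟩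
  | some w => if hw : c w = i then ⟨w, hw⟩ else ⟨r i, hc.color_root i⟩

theorem retract_none (hc : IsBranchColoring G r c) (i : ι) :
    hc.retract i none = ⟨r i, hc.color_root i⟩ := rfl

theorem retract_some (hc : IsBranchColoring G r c) {i : ι} (w : {w // c w = i}) :
    hc.retract i (some w) = w :=
  dif_pos w.2

theorem retract_of_ne (hc : IsBranchColoring G r c) {i : ι} {w : W} (hw : c w ≠ i) :
    hc.retract i (some w) = ⟨r i, hc.color_root i⟩ :=
  dif_neg hw

theorem retract_root (hc : IsBranchColoring G r c) (i k : ι) :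
    hc.retract i (some (r k)) = ⟨r i, hc.color_root i⟩ := by
  by_cases hki : k = i
  · subst hki
    exact hc.retract_some ⟨r k, hc.color_root k⟩
  · exact hc.retract_of_ne (by rwa [hc.color_root])

theorem reachable_retract (hc : IsBranchColoring G r c) (i : ι) {x y : Option W}
    (h : G.Reachable x y) : (branch G c i).Reachable (hc.retract i x) (hc.retract i y) := by
  refine reachable_of_forall_adj_reachable (hc.retract i) (fun x y hxy => ?_) h
  match x, y, hxy with
  | none, none, hxy => exact (G.loopless.irrefl _ hxy).elim
  | none, some w, hxy =>
    obtain ⟨k, rfl⟩ := (hc.adj_none_iff w).1 hxy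
    rw [hc.retract_none, hc.retract_root]
  | some w, none, hxy =>
    obtain ⟨k, rfl⟩ := (hc.adj_none_iff w).1 hxy.symm
    rw [hc.retract_none, hc.retract_root]
  | some v, some w, hxy =>
    have hcolor := hc.color_eq_of_adj v w hxy
    by_cases hw : c w = i
    · rw [hc.retract_some ⟨v, hcolor.trans hw⟩, hc.retract_some ⟨w, hw⟩]
      exact SimpleGraph.Adj.reachable (G := branch G c i) hxy
    · rw [hc.retract_of_ne (hcolor ▸ hw), hc.retract_of_ne hw]

theorem reachable_branch (hc : IsBranchColoring G r c) {i : ι} {v w : {w // c w = i}}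
    (h : G.Reachable (some v.1) (some w.1)) : (branch G c i).Reachable v w := by
  simpa only [hc.retract_some] using hc.reachable_retract i h

theorem connected_iff (hc : IsBranchColoring G r c) :
    G.Connected ↔ ∀ i, (branch G c i).Connected := by
  refine ⟨fun h i => ?_, fun h => ?_⟩
  · have : Nonempty {w // c w = i} := ⟨⟨r i, hc.color_root i⟩⟩
    exact ⟨fun v w => hc.reachable_branch (h.preconnected _ _)⟩
  · refine G.connected_iff_exists_forall_reachable.2 ⟨none, fun x => ?_⟩
    rcases x with _ | w
    · exact .refl _
    · have hroot : G.Adj none (some (r (c w))) := (hc.adj_none_iff _).2 ⟨_, rfl⟩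
      exact hroot.reachable.trans <| SimpleGraph.Reachable.map
        (⟨fun w => some w.1, fun h => h⟩ : branch G c (c w) →g G)
        ((h (c w)).preconnected ⟨r (c w), hc.color_root _⟩ ⟨w, rfl⟩)

theorem isBridge_root (hc : IsBranchColoring G r c) (i : ι) : G.IsBridge s(none, some (r i)) := by
  rw [SimpleGraph.isBridge_iff]
  intro h
  have hside : (none : Option W).elim False (c · = i) = (some (r i)).elim False (c · = i) := by
    refine eq_of_reachable_of_forall_adj_eq (f := fun x => x.elim False (c · = i))
      (fun x y hxy => ?_) h
    rw [SimpleGraph.deleteEdges_adj] at hxy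
    have hne (k : ι) (hk : c (r k) = i) : s(none, some (r k)) = s(none, some (r i)) := by
      rw [← hk, hc.color_root]
    match x, y, hxy with
    | none, none, _ => rfl
    | none, some w, hxy =>
      obtain ⟨k, rfl⟩ := (hc.adj_none_iff w).1 hxy.1
      exact (eq_false fun hk => hxy.2 (hne k hk)).symm
    | some w, none, hxy =>
      obtain ⟨k, rfl⟩ := (hc.adj_none_iff w).1 hxy.1.symm
      exact eq_false fun hk => hxy.2 (Sym2.eq_swap.trans (hne k hk))
    | some v, some w, hxy => exact congrArg (· = i) (hc.color_eq_of_adj v w hxy.1)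
  exact hside.mpr (hc.color_root i)

theorem deleteEdges_some (hc : IsBranchColoring G r c) (v w : W) :
    IsBranchColoring (G.deleteEdges {s(some v, some w)}) r c where
  adj_none_iff x := by
    rw [SimpleGraph.deleteEdges_adj, hc.adj_none_iff, and_iff_left (by simp)]
  color_root := hc.color_root
  color_eq_of_adj x y h := hc.color_eq_of_adj x y (SimpleGraph.deleteEdges_adj.1 h).1

theorem branch_deleteEdges_some {i : ι} (v w : {w // c w = i}) :
    branch (G.deleteEdges {s(some v.1, some w.1)}) c i = (branch G c i).deleteEdges {s(v, w)} := by
  ext x y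
  simp [branch, SimpleGraph.deleteEdges_adj, Subtype.ext_iff]

theorem isAcyclic_iff (hc : IsBranchColoring G r c) :
    G.IsAcyclic ↔ ∀ i, (branch G c i).IsAcyclic := by
  refine ⟨fun h i => h.of_comap ⟨_, (Option.some_injective W).comp Subtype.val_injective⟩,
    fun h => SimpleGraph.isAcyclic_iff_forall_adj_isBridge.2 fun x y hxy => ?_⟩
  match x, y, hxy with
  | none, none, hxy => exact (G.loopless.irrefl _ hxy).elim
  | none, some w, hxy =>
    obtain ⟨i, rfl⟩ := (hc.adj_none_iff w).1 hxy
    exact hc.isBridge_root i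
  | some w, none, hxy =>
    obtain ⟨i, rfl⟩ := (hc.adj_none_iff w).1 hxy.symm
    exact Sym2.eq_swap ▸ hc.isBridge_root i
  | some v, some w, hxy =>
    let v' : {x // c x = c w} := ⟨v, hc.color_eq_of_adj v w hxy⟩
    let w' : {x // c x = c w} := ⟨w, rfl⟩
    have hbridge : (branch G c (c w)).IsBridge s(v', w') :=
      SimpleGraph.isAcyclic_iff_forall_adj_isBridge.1 (h (c w)) hxy
    rw [SimpleGraph.isBridge_iff] at hbridge ⊢
    rw [← branch_deleteEdges_some] at hbridge
    exact fun hvw => hbridge ((hc.deleteEdges_some v w).reachable_branch hvw)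

theorem isTree_iff (hc : IsBranchColoring G r c) : G.IsTree ↔ ∀ i, (branch G c i).IsTree := by
  simp only [SimpleGraph.isTree_iff, hc.connected_iff, hc.isAcyclic_iff, forall_and]

end IsBranchColoring

end Branches

namespace MultiHypergraph

variable {V E : Type*} {H : MultiHypergraph V E}

/-- The bipartite incidence graph of a hypergraph, on the disjoint union of its vertices and its
edges. -/
def incGraph (H : MultiHypergraph V E) : SimpleGraph (V ⊕ E) where
  Adj
    | .inl v, .inr e => v ∈ H.ends e
    | .inr e, .inl v => v ∈ H.ends e
    | _, _ => False
  symm := ⟨by rintro (v | e) (w | f) h <;> exact h⟩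
  loopless := ⟨by rintro (v | e) h <;> exact h⟩

@[simp] theorem incGraph_adj_inl_inr {v : V} {e : E} :
    H.incGraph.Adj (.inl v) (.inr e) ↔ v ∈ H.ends e := Iff.rfl

@[simp] theorem incGraph_adj_inr_inl {v : V} {e : E} :
    H.incGraph.Adj (.inr e) (.inl v) ↔ v ∈ H.ends e := Iff.rfl

@[simp] theorem not_incGraph_adj_inl_inl {v w : V} : ¬ H.incGraph.Adj (.inl v) (.inl w) := id

@[simp] theorem not_incGraph_adj_inr_inr {e f : E} : ¬ H.incGraph.Adj (.inr e) (.inr f) := id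

theorem reachable_of_mem_ends {v : V} {e : E} (h : v ∈ H.ends e) :
    H.incGraph.Reachable (.inl v) (.inr e) :=
  SimpleGraph.Adj.reachable (G := H.incGraph) h

theorem ends_nonempty (H : MultiHypergraph V E) (e : E) : (H.ends e).Nonempty :=
  Finset.card_pos.1 (two_pos.trans_le (H.two_le_card e))

theorem IsWalk.reachable {m : ℕ} {v : Fin (m + 1) → V} {e : Fin m → E} (h : H.IsWalk v e)
    (i : Fin (m + 1)) : H.incGraph.Reachable (.inl (v 0)) (.inl (v i)) := by
  induction i using Fin.induction with
  | zero => exact .refl _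
  | succ i ih =>
    exact ih.trans ((reachable_of_mem_ends (h i).1).trans (reachable_of_mem_ends (h i).2).symm)

theorem IsConnected.connected_incGraph [Nonempty V] (h : H.IsConnected) :
    H.incGraph.Connected := by
  have reachable_vertex (a b : V) : H.incGraph.Reachable (.inl a) (.inl b) := by
    obtain ⟨m, v, e, hpath, rfl, rfl⟩ := h a b
    exact hpath.1.reachable _
  obtain ⟨a⟩ := ‹Nonempty V›
  refine H.incGraph.connected_iff_exists_forall_reachable.2 ⟨.inl a, ?_⟩
  rintro (b | e)
  · exact reachable_vertex a b
  · obtain ⟨b, hb⟩ := H.ends_nonempty e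
    exact (reachable_vertex a b).trans (reachable_of_mem_ends hb)

-- Going around the cycle the other way shows that its first incidence is not a bridge.
theorem IsCycle.not_isAcyclic_incGraph {m : ℕ} {v : Fin (m + 1) → V} {e : Fin m → E}
    (h : H.IsCycle v e) : ¬ H.incGraph.IsAcyclic := by
  obtain ⟨hwalk, hm, he, hv, hlast⟩ := h
  obtain ⟨m, rfl⟩ := Nat.exists_eq_add_of_le' hm
  intro hacyclic
  have hbridge : H.incGraph.IsBridge s(.inl (v 0), .inr (e 0)) :=
    SimpleGraph.isAcyclic_iff_forall_adj_isBridge.1 hacyclic (hwalk 0).1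
  rw [SimpleGraph.isBridge_iff] at hbridge
  set G := H.incGraph.deleteEdges {s(.inl (v 0), .inr (e 0))}
  have reachable_of_ne {a : V} {f : E} (hmem : a ∈ H.ends f) (hne : a ≠ v 0 ∨ f ≠ e 0) :
      G.Reachable (.inl a) (.inr f) := by
    refine SimpleGraph.Adj.reachable (SimpleGraph.deleteEdges_adj.2 ⟨hmem, ?_⟩)
    simpa [or_iff_not_imp_left] using hne
  have reachable_succ (i : Fin (m + 2)) : G.Reachable (.inr (e 0)) (.inl (v i.succ)) := by
    induction i using Fin.induction with
    | zero =>
      refine (reachable_of_ne (hwalk 0).2 (.inl fun h => ?_)).symm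
      exact absurd (@hv 1 0 h) (by simp)
    | succ i ih =>
      have hne : e i.succ ≠ e 0 := he.ne (Fin.succ_ne_zero i)
      exact ih.trans ((reachable_of_ne (hwalk i.succ).1 (.inr hne)).trans
        (reachable_of_ne (hwalk i.succ).2 (.inr hne)).symm)
  have hreturn := reachable_succ (Fin.last _)
  rw [Fin.succ_last, hlast] at hreturn
  exact hbridge hreturn.symm

theorem isLeft_getVert_iff {x y : V ⊕ E} (hx : x.isLeft) (p : H.incGraph.Walk x y) {i : ℕ}
    (hi : i ≤ p.length) : (p.getVert i).isLeft ↔ Even i := by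
  induction i with
  | zero => simpa using hx
  | succ i ih =>
    have hadj := p.adj_getVert_succ (i := i) (by omega)
    rw [Nat.even_add_one, ← ih (by omega)]
    revert hadj
    cases p.getVert i <;> cases p.getVert (i + 1) <;> simp

theorem exists_isWalk_of_walk {a b : V} (p : H.incGraph.Walk (.inl a) (.inl b)) :
    ∃ (m : ℕ) (v : Fin (m + 1) → V) (e : Fin m → E), p.length = 2 * m ∧ H.IsWalk v e ∧
      (∀ i : Fin (m + 1), p.getVert (2 * i) = .inl (v i)) ∧
      (∀ i : Fin m, p.getVert (2 * i + 1) = .inr (e i)) := by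
  obtain ⟨m, hm⟩ : Even p.length := by
    rw [← isLeft_getVert_iff rfl p le_rfl, p.getVert_length, Sum.isLeft_inl]
  have exists_vertex (i : Fin (m + 1)) : ∃ v, p.getVert (2 * i) = .inl v :=
    Sum.isLeft_iff.1 ((isLeft_getVert_iff rfl p (by omega)).2 (even_two_mul _))
  have exists_edge (i : Fin m) : ∃ e, p.getVert (2 * i + 1) = .inr e := by
    have hleft := (isLeft_getVert_iff rfl p (i := 2 * i + 1) (by omega)).not.2 (by simp)
    exact Sum.isRight_iff.1 (by simpa using hleft)
  choose v hv using exists_vertex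
  choose e he using exists_edge
  refine ⟨m, v, e, by omega, fun i => ⟨?_, ?_⟩, hv, he⟩
  · have hadj := p.adj_getVert_succ (i := 2 * i) (by omega)
    rwa [he i, ← Fin.val_castSucc i, hv] at hadj
  · have hadj := p.adj_getVert_succ (i := 2 * i + 1) (by omega)
    rwa [he i, show 2 * (i : ℕ) + 1 + 1 = 2 * (i.succ : ℕ) by simp; ring, hv] at hadj

theorem isConnected_of_connected_incGraph (h : H.incGraph.Connected) : H.IsConnected := by
  intro a b
  obtain ⟨p, hp⟩ := h.exists_isPath (.inl a) (.inl b)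
  obtain ⟨m, v, e, hm, hwalk, hv, he⟩ := exists_isWalk_of_walk p
  have hinj {i j : ℕ} (hi : i ≤ 2 * m) (hj : j ≤ 2 * m) (hij : p.getVert i = p.getVert j) : i = j :=
    hp.getVert_injOn (hi.trans_eq hm.symm) (hj.trans_eq hm.symm) hij
  refine ⟨m, v, e, ⟨hwalk, fun i j hij => ?_, fun i j hij => ?_⟩, ?_, ?_⟩
  · have := @hinj (2 * i) (2 * j) (by omega) (by omega) (by rw [hv, hv, hij])
    omega
  · have := @hinj (2 * i + 1) (2 * j + 1) (by omega) (by omega) (by rw [he, he, hij])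
    omega
  · exact Sum.inl_injective ((hv 0).symm.trans p.getVert_zero)
  · have hlast := hv (Fin.last m)
    rw [Fin.val_last, ← hm, p.getVert_length] at hlast
    exact Sum.inl_injective hlast.symm

theorem exists_isCycle_of_isCycle_incGraph {a : V} {p : H.incGraph.Walk (.inl a) (.inl a)}
    (hp : p.IsCycle) : ∃ (m : ℕ) (v : Fin (m + 1) → V) (e : Fin m → E), H.IsCycle v e := by
  obtain ⟨m, v, e, hm, hwalk, hv, he⟩ := exists_isWalk_of_walk p
  have hinj {i j : ℕ} (hi : i ≤ 2 * m - 1) (hj : j ≤ 2 * m - 1)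
      (hij : p.getVert i = p.getVert j) : i = j :=
    hp.getVert_injOn' (by simpa [hm] using hi) (by simpa [hm] using hj) hij
  have hlength := hp.three_le_length
  refine ⟨m, v, e, hwalk, by omega, fun i j hij => ?_, fun i j hij => ?_, ?_⟩
  · have := @hinj (2 * i + 1) (2 * j + 1) (by omega) (by omega) (by rw [he, he, hij])
    omega
  · have := @hinj (2 * i.castSucc) (2 * j.castSucc) (by simp only [Fin.val_castSucc]; omega)
      (by simp only [Fin.val_castSucc]; omega) (by rw [hv, hv]; exact congrArg Sum.inl hij)
    simp only [Fin.val_castSucc] at this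
    omega
  · have hfirst := hv 0
    have hlast := hv (Fin.last m)
    rw [Fin.val_last, ← hm, p.getVert_length] at hlast
    exact Sum.inl_injective (hlast.symm.trans (p.getVert_zero.symm.trans hfirst))

theorem isAcyclic_incGraph_of_not_exists_isCycle
    (h : ¬ ∃ (m : ℕ) (v : Fin (m + 1) → V) (e : Fin m → E), H.IsCycle v e) :
    H.incGraph.IsAcyclic := by
  classical
  rintro (a | f) p hp
  · exact h (exists_isCycle_of_isCycle_incGraph hp)
  · have hadj : H.incGraph.Adj (.inr f) (p.getVert 1) := p.adj_snd hp.not_nil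
    have hmem := p.getVert_mem_support 1
    cases hsnd : p.getVert 1 with
    | inl a => exact h (exists_isCycle_of_isCycle_incGraph (hp.rotate (hsnd ▸ hmem)))
    | inr g => exact not_incGraph_adj_inr_inr (hsnd ▸ hadj)

theorem isTree_incGraph_iff : H.incGraph.IsTree ↔ Nonempty V ∧ H.IsHypertree := by
  refine ⟨fun h => ⟨?_, isConnected_of_connected_incGraph h.connected, ?_⟩, ?_⟩
  · obtain ⟨v | e⟩ := h.connected.nonempty
    · exact ⟨v⟩
    · exact (H.ends_nonempty e).to_type
  · rintro ⟨m, v, e, hcycle⟩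
    exact hcycle.not_isAcyclic_incGraph h.isAcyclic
  · rintro ⟨_, hconn, hcycle⟩
    exact ⟨hconn.connected_incGraph, isAcyclic_incGraph_of_not_exists_isCycle hcycle⟩

theorem card_edgeSet_incGraph [Fintype E] (H : MultiHypergraph V E) :
    Nat.card H.incGraph.edgeSet = ∑ e, (H.ends e).card := by
  let incidence (x : Σ e, H.ends e) : H.incGraph.edgeSet := ⟨s(.inl x.2.1, .inr x.1), x.2.2⟩
  have injective_incidence : Function.Injective incidence := by
    rintro ⟨e, v, hv⟩ ⟨f, w, hw⟩ h
    obtain ⟨rfl, rfl⟩ : v = w ∧ e = f := by simpa [incidence] using congrArg Subtype.val h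
    rfl
  have surjective_incidence : Function.Surjective incidence := by
    rintro ⟨x, hx⟩
    induction x using Sym2.ind with
    | _ x y =>
      match x, y, hx with
      | .inl v, .inr e, hx => exact ⟨⟨e, v, hx⟩, rfl⟩
      | .inr e, .inl v, hx => exact ⟨⟨e, v, hx⟩, Subtype.ext Sym2.eq_swap⟩
  rw [← Nat.card_eq_of_bijective incidence ⟨injective_incidence, surjective_incidence⟩,
    Nat.card_sigma]
  simp only [Nat.card_eq_fintype_card, Fintype.card_coe]

theorem sum_card_ends_add_one [Fintype V] [Fintype E] (h : H.incGraph.IsTree) :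
    ∑ e, (H.ends e).card + 1 = Fintype.card V + Fintype.card E := by
  rw [← card_edgeSet_incGraph, (SimpleGraph.isTree_iff_connected_and_card.1 h).2,
    Nat.card_eq_fintype_card, Fintype.card_sum]

end MultiHypergraph

theorem sum_card_eq_card_of_existsUnique {α β : Type*} [Finite α] [Fintype β] {p : α → Prop}
    {q : α → β → Prop} (hqp : ∀ a b, q a b → p a) (h : ∀ a, p a → ∃! b, q a b) :
    ∑ b, Nat.card {a // q a b} = Nat.card {a // p a} := by
  rw [← Nat.card_sigma]
  refine Nat.card_eq_of_bijective (fun x => ⟨x.2.1, hqp _ _ x.2.2⟩) ⟨?_, fun ⟨a, ha⟩ => ?_⟩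
  · rintro ⟨b, a, hab⟩ ⟨b', a', hab'⟩ haa'
    obtain rfl : a = a' := congrArg Subtype.val haa'
    obtain rfl := (h a (hqp a b hab)).unique hab hab'
    rfl
  · obtain ⟨b, hb, -⟩ := h a ha
    exact ⟨⟨b, a, hb⟩, rfl⟩

theorem card_injective_range_eq {α β : Type*} [Finite α] {s : Set β} [Finite s]
    (h : Nat.card s = Nat.card α) :
    Nat.card {f : α → β // Function.Injective f ∧ Set.range f = s} = (Nat.card α)! := by
  let rangeEquiv : {f : α → β // Function.Injective f ∧ Set.range f = s} ≃ (α ≃ s) :=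
    { toFun f := (Equiv.ofInjective f.1 f.2.1).trans (Equiv.setCongr f.2.2)
      invFun e := ⟨Subtype.val ∘ e, Subtype.val_injective.comp e.injective, by
        rw [e.surjective.range_comp, Subtype.range_coe]⟩
      left_inv _ := rfl
      right_inv _ := Equiv.ext fun _ => rfl }
  obtain ⟨e⟩ := Finite.card_eq.1 h
  rw [Nat.card_congr (rangeEquiv.trans ((Equiv.refl α).equivCongr e)), ← Nat.card_perm]

namespace MultiHypergraph

section Splitting

variable {V E ι : Type*} {H : MultiHypergraph V (Option E)} {r : ι → V} {c : V ⊕ E → ι}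

/-- The incidence graph of a hypergraph with a distinguished edge `none`, in which this edge is
the vertex `none`. -/
def pointedIncGraph (H : MultiHypergraph V (Option E)) : SimpleGraph (Option (V ⊕ E)) :=
  H.incGraph.comap fun x => x.elim (.inr none) (Sum.map id some)

theorem isTree_pointedIncGraph_iff : H.pointedIncGraph.IsTree ↔ H.incGraph.IsTree := by
  let vertexEquiv : Option (V ⊕ E) ≃ V ⊕ Option E :=
    { toFun x := x.elim (.inr none) (Sum.map id some)
      invFun := Sum.elim (some ∘ .inl) (Option.map .inr)
      left_inv := by rintro (_ | _ | _) <;> rfl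
      right_inv := by rintro (_ | _ | _) <;> rfl }
  exact (SimpleGraph.Iso.comap vertexEquiv H.incGraph).isTree_iff

/-- The vertices of the edge `none` are the `r i`, and `c` assigns the vertices and the other
edges to the components that remain when the edge `none` is removed; `r i` lies in the
component `i`. -/
def IsSplitting (H : MultiHypergraph V (Option E)) (r : ι → V) (c : V ⊕ E → ι) : Prop :=
  IsBranchColoring H.pointedIncGraph (fun i => .inl (r i)) c

theorem pointedIncGraph_adj_none_iff (hr : Set.range r = H.ends none) (x : V ⊕ E) :
    H.pointedIncGraph.Adj none (some x) ↔ x ∈ Set.range fun i => (.inl (r i) : V ⊕ E) := by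
  rcases x with v | e
  · refine (Finset.mem_coe.symm.trans (by rw [← hr])).trans ?_
    simp
  · simp [pointedIncGraph]

theorem isSplitting_iff : H.IsSplitting r c ↔ Set.range r = H.ends none ∧
    (∀ i, c (.inl (r i)) = i) ∧ ∀ v e, v ∈ H.ends (some e) → c (.inl v) = c (.inr e) := by
  refine ⟨fun h =>
    ⟨Set.ext fun v => ?_, h.color_root, fun v e => h.color_eq_of_adj (.inl v) (.inr e)⟩,
    fun ⟨hends, hroot, hmem⟩ => ⟨pointedIncGraph_adj_none_iff hends, hroot, ?_⟩⟩
  · have hadj := h.adj_none_iff (.inl v)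
    simp only [Set.mem_range, Sum.inl.injEq] at hadj
    exact hadj.symm
  · rintro (v | e) (w | f) h
    · exact h.elim
    · exact hmem v f h
    · exact (hmem w e h).symm
    · exact h.elim

theorem existsUnique_isSplitting (hH : H.incGraph.IsTree) (hr : Function.Injective r)
    (hr' : Set.range r = H.ends none) : ∃! c, H.IsSplitting r c :=
  IsBranchColoring.existsUnique (isTree_pointedIncGraph_iff.2 hH)
    (pointedIncGraph_adj_none_iff hr') (Sum.inl_injective.comp hr)

namespace IsSplitting

theorem range_eq (hc : H.IsSplitting r c) : Set.range r = H.ends none := (isSplitting_iff.1 hc).1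

theorem color_root (hc : H.IsSplitting r c) (i : ι) : c (.inl (r i)) = i :=
  IsBranchColoring.color_root hc i

theorem injective (hc : H.IsSplitting r c) : Function.Injective r :=
  Function.LeftInverse.injective (g := fun v => c (.inl v)) hc.color_root

theorem color_eq_of_mem (hc : H.IsSplitting r c) {v : V} {e : E} (h : v ∈ H.ends (some e)) :
    c (.inl v) = c (.inr e) :=
  (isSplitting_iff.1 hc).2.2 v e h

theorem card_preimage_ends (hc : H.IsSplitting r c) {i : ι} (e : {e // c (.inr e) = i}) :
    ((H.ends (some e.1)).preimage (Subtype.val : {v // c (.inl v) = i} → V)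
      Subtype.val_injective.injOn).card = (H.ends (some e.1)).card := by
  classical
  rw [Finset.card_preimage, Finset.filter_true_of_mem fun v hv => ?_]
  exact ⟨⟨v, (hc.color_eq_of_mem hv).trans e.2⟩, rfl⟩

/-- The component that contains `r i` in the hypergraph without the edge `none`. -/
noncomputable def part (hc : H.IsSplitting r c) (i : ι) :
    MultiHypergraph {v // c (.inl v) = i} {e // c (.inr e) = i} where
  ends e := (H.ends (some e.1)).preimage Subtype.val Subtype.val_injective.injOn
  two_le_card e := (H.two_le_card _).trans_eq (hc.card_preimage_ends e).symm

/-- The branches at the edge `none` are the incidence graphs of the components. -/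
noncomputable def branchIsoIncGraph (hc : H.IsSplitting r c) (i : ι) :
    branch H.pointedIncGraph c i ≃g (hc.part i).incGraph where
  toEquiv := Equiv.subtypeSum
  map_rel_iff' := by
    rintro ⟨v | e, _⟩ ⟨w | f, _⟩
    · exact Iff.rfl
    · exact Finset.mem_preimage (hf := Subtype.val_injective.injOn)
    · exact Finset.mem_preimage (hf := Subtype.val_injective.injOn)
    · exact Iff.rfl

theorem isTree_iff (hc : H.IsSplitting r c) :
    H.incGraph.IsTree ↔ ∀ i, (hc.part i).incGraph.IsTree := by
  rw [← isTree_pointedIncGraph_iff, IsBranchColoring.isTree_iff hc]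
  exact forall_congr' fun i => (hc.branchIsoIncGraph i).isTree_iff

end IsSplitting

section Glue

variable [Fintype ι] (c) (hι : 2 ≤ Fintype.card ι) (x : ∀ i, {v // c (.inl v) = i})
  (K : ∀ i, MultiHypergraph {v // c (.inl v) = i} {e // c (.inr e) = i})

/-- The hypergraph obtained from disjoint rooted hypergraphs by joining their roots by the edge
`none`. -/
def glue : MultiHypergraph V (Option E) where
  ends
    | none => Finset.univ.map ⟨fun i => (x i : V),
        Function.LeftInverse.injective (g := fun v => c (.inl v)) fun i => (x i).2⟩
    | some e => ((K (c (.inr e))).ends ⟨e, rfl⟩).map (.subtype _)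
  two_le_card
    | none => by rwa [Finset.card_map]
    | some e => by rw [Finset.card_map]; exact (K _).two_le_card _

theorem isSplitting_glue : (glue c hι x K).IsSplitting (fun i => (x i : V)) c := by
  refine isSplitting_iff.2 ⟨?_, fun i => (x i).2, fun v e hv => ?_⟩
  · simp [glue]
  · obtain ⟨w, -, rfl⟩ := Finset.mem_map.1 hv
    exact w.2

theorem part_glue (i : ι) : (isSplitting_glue c hι x K).part i = K i := by
  ext ⟨e, rfl⟩ ⟨v, hv⟩
  simp [IsSplitting.part, glue, hv]

theorem glue_part (hc : H.IsSplitting r c) :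
    glue c hι (fun i => ⟨r i, hc.color_root i⟩) hc.part = H := by
  ext (_ | e) v
  · simp [glue, ← Finset.mem_coe, ← hc.range_eq]
  · simpa [glue, IsSplitting.part] using hc.color_eq_of_mem

end Glue

end Splitting

/-- The hypertrees with edges of prescribed sizes, in terms of the incidence graph; the empty
hypergraph is thus not among them. -/
abbrev SizedHypertree (V : Type*) {E : Type*} (s : E → ℕ) : Type _ :=
  {H : MultiHypergraph V E // (∀ e, (H.ends e).card = s e) ∧ H.incGraph.IsTree}

instance {V E : Type*} [Finite V] [Finite E] (s : E → ℕ) : Finite (SizedHypertree V s) :=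
  inferInstanceAs (Finite {_H : MultiHypergraph V E // _})

section Counting

variable {V E ι : Type*} [Fintype ι]

/-- Hypertrees whose edge `none` is split by `c` correspond to families of rooted hypertrees. -/
noncomputable def splittingEquiv (hι : 2 ≤ Fintype.card ι) (s : Option E → ℕ)
    (hs : s none = Fintype.card ι) (c : V ⊕ E → ι) :
    {p : SizedHypertree V s × (ι → V) // p.1.1.IsSplitting p.2 c} ≃
    ∀ i, {v // c (.inl v) = i} ×
      SizedHypertree {v // c (.inl v) = i} fun e : {e // c (.inr e) = i} => s (some e) where
  toFun p i := (⟨p.1.2 i, p.2.color_root i⟩, ⟨p.2.part i,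
    fun e => (p.2.card_preimage_ends e).trans (p.1.1.2.1 _), p.2.isTree_iff.1 p.1.1.2.2 i⟩)
  invFun q :=
    have hsplit := isSplitting_glue c hι (fun i => (q i).1) fun i => (q i).2.1
    ⟨(⟨glue c hι (fun i => (q i).1) fun i => (q i).2.1, by
      rintro (_ | e)
      · simp [glue, hs]
      · simpa [glue] using (q (c (.inr e))).2.2.1 ⟨e, rfl⟩,
      hsplit.isTree_iff.2 fun i => by rw [part_glue]; exact (q i).2.2.2⟩, fun i => (q i).1), hsplit⟩
  left_inv p := Subtype.ext (Prod.ext (Subtype.ext (glue_part c hι p.2)) rfl)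
  right_inv q := funext fun i => Prod.ext rfl <| Subtype.ext <|
    part_glue c hι (fun i => (q i).1) (fun i => (q i).2.1) i

theorem card_prod_injective_range_eq [Finite V] [Finite E] {s : Option E → ℕ}
    (hs : s none = Fintype.card ι) :
    Nat.card {p : SizedHypertree V s × (ι → V) //
      Function.Injective p.2 ∧ Set.range p.2 = p.1.1.ends none} =
    Nat.card (SizedHypertree V s) * (Fintype.card ι)! := by
  have := Fintype.ofFinite (SizedHypertree V s)
  have card_enumerations (H : SizedHypertree V s) :
      Nat.card {r : ι → V // Function.Injective r ∧ Set.range r = H.1.ends none} =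
        (Fintype.card ι)! := by
    rw [card_injective_range_eq (by simpa using (H.2.1 none).trans hs), Nat.card_eq_fintype_card]
  rw [Nat.card_congr (Equiv.subtypeProdEquivSigmaSubtype fun (H : SizedHypertree V s) (r : ι → V) =>
    Function.Injective r ∧ Set.range r = H.1.ends none), Nat.card_sigma]
  simp only [card_enumerations, Finset.sum_const, smul_eq_mul, Finset.card_univ,
    Nat.card_eq_fintype_card]

theorem sum_prod_card_rooted [Fintype (V ⊕ E → ι)] [Finite V] [Finite E] (hι : 2 ≤ Fintype.card ι)
    {s : Option E → ℕ} (hs : s none = Fintype.card ι) :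
    ∑ c : V ⊕ E → ι, ∏ i, Nat.card {v // c (.inl v) = i} * Nat.card
      (SizedHypertree {v // c (.inl v) = i} fun e : {e // c (.inr e) = i} => s (some e)) =
    Nat.card (SizedHypertree V s) * (Fintype.card ι)! := by
  simp_rw [← card_prod_injective_range_eq hs, ← Nat.card_prod, ← Nat.card_pi,
    ← fun c => Nat.card_congr (splittingEquiv hι s hs c)]
  exact sum_card_eq_card_of_existsUnique (fun _ _ h => ⟨h.injective, h.range_eq⟩)
    fun p hp => existsUnique_isSplitting p.1.2.2 hp.1 hp.2

end Counting

section Relabel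

variable {V V' E E' : Type*}

/-- Renaming the vertices and the edges of a hypergraph. -/
def relabel (f : V ≃ V') (g : E ≃ E') : MultiHypergraph V E ≃ MultiHypergraph V' E' where
  toFun H := ⟨fun e => (H.ends (g.symm e)).map f.toEmbedding,
    fun e => (H.two_le_card _).trans_eq (Finset.card_map _).symm⟩
  invFun H := ⟨fun e => (H.ends (g e)).map f.symm.toEmbedding,
    fun e => (H.two_le_card _).trans_eq (Finset.card_map _).symm⟩
  left_inv H := by ext; simp
  right_inv H := by ext; simp

/-- Renaming vertices and edges is an isomorphism of incidence graphs. -/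
def relabelIso (f : V ≃ V') (g : E ≃ E') (H : MultiHypergraph V E) :
    H.incGraph ≃g (relabel f g H).incGraph where
  toEquiv := f.sumCongr g
  map_rel_iff' := by rintro (v | e) (w | k) <;> simp [relabel]

theorem card_sizedHypertree_congr {s : E → ℕ} {s' : E' → ℕ} (f : V ≃ V') (g : E ≃ E')
    (h : ∀ e, s' (g e) = s e) :
    Nat.card (SizedHypertree V s) = Nat.card (SizedHypertree V' s') := by
  refine Nat.card_congr <| (relabel f g).subtypeEquiv fun H =>
    and_congr ?_ (relabelIso f g H).isTree_iff
  rw [← g.forall_congr_right]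
  simp [relabel, h]

end Relabel

end MultiHypergraph

section ProductFormula

open MvPowerSeries

theorem derivation_prod {R A ι : Type*} [CommSemiring R] [CommSemiring A] [Algebra R A]
    [DecidableEq ι] (D : Derivation R A A) (s : Finset ι) (f : ι → A) :
    D (∏ i ∈ s, f i) = ∑ i ∈ s, ∏ k ∈ s, Function.update f i (D (f i)) k := by
  induction s using Finset.induction_on with
  | empty => simp
  | insert a s ha ih =>
    have update_off (i : ι) (hi : i ∈ s) :
        ∏ k ∈ insert a s, Function.update f i (D (f i)) k =
          f a * ∏ k ∈ s, Function.update f i (D (f i)) k := by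
      rw [Finset.prod_insert ha, Function.update_of_ne (ne_of_mem_of_not_mem hi ha).symm]
    rw [Finset.prod_insert ha, Derivation.leibniz, ih, Finset.sum_insert ha,
      Finset.prod_update_of_mem (Finset.mem_insert_self a s), Finset.sdiff_singleton_eq_erase,
      Finset.erase_insert ha, Finset.sum_congr rfl update_off, ← Finset.mul_sum, smul_eq_mul,
      smul_eq_mul, add_comm, mul_comm (D (f a))]

variable {σ R : Type*} [CommSemiring R]

theorem coeff_X_mul_pderiv (i : σ) (d : σ →₀ ℕ) (F : MvPowerSeries σ R) :
    coeff d (X i * pderiv R i F) = d i * coeff d F := by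
  classical
  rw [X, coeff_monomial_mul, one_mul]
  split_ifs with h
  · obtain ⟨e, rfl⟩ := exists_add_of_le h
    rw [add_tsub_cancel_left, coeff_pderiv, add_comm e, mul_comm]
    simp [add_comm]
  · have : d i = 0 := by simpa [Finsupp.single_le_iff] using h
    simp [this]

theorem prod_factorial_add_single (d : σ →₀ ℕ) (i : σ) :
    ((d + Finsupp.single i 1).prod fun _ k => k !) = (d i + 1) * d.prod fun _ k => k ! := by
  classical
  have prod_eq (e : σ →₀ ℕ) :
      (e.prod fun _ k => k !) = (e i)! * (e.erase i).prod fun _ k => k ! :=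
    (Finsupp.mul_prod_erase' e i _ fun _ => rfl).symm
  rw [prod_eq, prod_eq d, ← mul_assoc, Finsupp.erase_add, Finsupp.erase_single, add_zero]
  simp [Nat.factorial_succ]

theorem prod_factorial_option {α : Type*} (d : Option α →₀ ℕ) :
    (d.prod fun _ k => k !) = (d none)! * d.some.prod fun _ k => k ! := by
  rw [Finsupp.prod_of_support_subset d (s := Finset.insertNone d.some.support) _ _ (by simp),
    Finset.prod_insertNone]
  · rfl
  · rintro (_ | j) h
    · simp
    · simpa using h

/-- The coefficient of `∏ i, X i ^ d i / (d i)!` in `F`, which is what an exponential generating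
function counts. -/
noncomputable def egfCoeff (d : σ →₀ ℕ) (F : MvPowerSeries σ R) : R :=
  (d.prod fun _ k => k ! : ℕ) * coeff d F

theorem egfCoeff_add_single (d : σ →₀ ℕ) (i : σ) (F : MvPowerSeries σ R) :
    egfCoeff (d + Finsupp.single i 1) F = egfCoeff d (pderiv R i F) := by
  rw [egfCoeff, egfCoeff, prod_factorial_add_single, coeff_pderiv]
  push_cast
  ring

theorem egfCoeff_sum {ι : Type*} (d : σ →₀ ℕ) (s : Finset ι) (F : ι → MvPowerSeries σ R) :
    egfCoeff d (∑ i ∈ s, F i) = ∑ i ∈ s, egfCoeff d (F i) := by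
  simp only [egfCoeff, map_sum, Finset.mul_sum]

theorem egfCoeff_X_mul_pderiv (i : σ) (d : σ →₀ ℕ) (F : MvPowerSeries σ R) :
    egfCoeff d (X i * pderiv R i F) = d i * egfCoeff d F := by
  rw [egfCoeff, coeff_X_mul_pderiv, egfCoeff, mul_left_comm]

theorem prod_factorial_cast_ne_zero [CharZero R] (d : σ →₀ ℕ) :
    ((d.prod fun _ k => k ! : ℕ) : R) ≠ 0 :=
  Nat.cast_ne_zero.2 (Finset.prod_ne_zero_iff.2 fun _ _ => Nat.factorial_ne_zero _)

theorem ext_egfCoeff [CharZero R] [IsLeftCancelMulZero R] {F G : MvPowerSeries σ R}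
    (h : ∀ d, egfCoeff d F = egfCoeff d G) : F = G :=
  MvPowerSeries.ext fun d => mul_left_cancel₀ (prod_factorial_cast_ne_zero d) (h d)

/-- The exponent whose value at `a` is the number of labels of color `a`. A finite set of labels
colored by indeterminates gives the combinatorial reading of `egfCoeff`. -/
noncomputable def colorCount {L : Type*} [Finite L] (col : L → σ) : σ →₀ ℕ :=
  Finsupp.ofSupportFinite (fun a => Nat.card {l // col l = a}) <|
    (Set.finite_range col).subset fun _ ha =>
      have ⟨⟨l, hl⟩⟩ := (Nat.card_ne_zero.1 ha).1
      ⟨l, hl⟩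

theorem colorCount_apply {L : Type*} [Finite L] (col : L → σ) (a : σ) :
    colorCount col a = Nat.card {l // col l = a} := rfl

theorem colorCount_eq_sum {L : Type*} [Fintype L] (col : L → σ) :
    colorCount col = ∑ l, Finsupp.single (col l) 1 := by
  classical
  ext a
  simp [colorCount_apply, Finsupp.single_apply, Fintype.card_subtype]

theorem colorCount_comp_equiv {L L' : Type*} [Finite L] [Finite L'] (e : L ≃ L') (col : L' → σ) :
    colorCount (col ∘ e) = colorCount col := by
  ext a
  exact Nat.card_congr (e.subtypeEquiv fun _ => Iff.rfl)

theorem colorCount_of_isEmpty {L : Type*} [Finite L] [IsEmpty L] (col : L → σ) :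
    colorCount col = 0 := by
  ext a
  exact Nat.card_of_isEmpty

theorem colorCount_option {L : Type*} [Finite L] (col : Option L → σ) :
    colorCount col = colorCount (fun l => col (some l)) + Finsupp.single (col none) 1 := by
  have := Fintype.ofFinite L
  rw [colorCount_eq_sum, colorCount_eq_sum, Fintype.sum_option, add_comm]

theorem colorCount_fiber_eq_sum {ι L : Type*} [DecidableEq ι] [Fintype L] (col : L → σ)
    (c : L → ι) (i : ι) :
    colorCount (fun l : {l // c l = i} => col l) =
      ∑ l, if i = c l then Finsupp.single (col l) 1 else 0 := by
  rw [colorCount_eq_sum, ← Finset.sum_filter]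
  exact (Finset.sum_subtype _ (by simp [eq_comm]) fun l => Finsupp.single (col l) 1).symm

theorem colorCount_fiber_option {ι L : Type*} [DecidableEq ι] [Finite L] (col : Option L → σ)
    (c : Option L → ι) (i : ι) :
    colorCount (fun l : {l // c l = i} => col l) =
      colorCount (fun l : {l // c (some l) = i} => col (some l)) +
        if i = c none then Finsupp.single (col none) 1 else 0 := by
  have := Fintype.ofFinite L
  rw [colorCount_fiber_eq_sum, colorCount_fiber_eq_sum (fun l => col (some l)),
    Fintype.sum_option, add_comm]

theorem egfCoeff_prod_option {ι L : Type*} [Fintype ι] [Finite L] [Fintype (L → ι)]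
    [Fintype (Option L → ι)] (col : Option L → σ) (F : ι → MvPowerSeries σ R)
    (ih : ∀ G : ι → MvPowerSeries σ R, egfCoeff (colorCount fun l => col (some l)) (∏ i, G i) =
      ∑ c : L → ι, ∏ i, egfCoeff (colorCount fun l : {l // c l = i} => col (some l)) (G i)) :
    egfCoeff (colorCount col) (∏ i, F i) =
      ∑ c : Option L → ι, ∏ i, egfCoeff (colorCount fun l : {l // c l = i} => col l) (F i) := by
  classical
  rw [colorCount_option, egfCoeff_add_single, derivation_prod, egfCoeff_sum,
    ← Fintype.sum_equiv (Equiv.piOptionEquivProd (β := fun _ => ι)).symm _ _ fun _ => rfl,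
    Fintype.sum_prod_type]
  refine Finset.sum_congr rfl fun i₀ _ => (ih _).trans <| Finset.sum_congr rfl fun c _ =>
    Finset.prod_congr rfl fun i _ => ?_
  rw [colorCount_fiber_option]
  obtain rfl | hi := eq_or_ne i i₀
  · simp [Equiv.piOptionEquivProd, egfCoeff_add_single]
  · simp [Equiv.piOptionEquivProd, hi]

theorem egfCoeff_prod {ι L : Type*} [Fintype ι] [Finite L] [Fintype (L → ι)] (col : L → σ)
    (F : ι → MvPowerSeries σ R) :
    egfCoeff (colorCount col) (∏ i, F i) =
      ∑ c : L → ι, ∏ i, egfCoeff (colorCount fun l : {l // c l = i} => col l) (F i) := by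
  refine Finite.induction_empty_option (P := fun L => ∀ [Finite L] [Fintype (L → ι)] (col : L → σ)
    (F : ι → MvPowerSeries σ R), egfCoeff (colorCount col) (∏ i, F i) =
      ∑ c : L → ι, ∏ i, egfCoeff (colorCount fun l : {l // c l = i} => col l) (F i))
    (fun {L L'} e ih _ _ col F => ?_) (fun _ F => ?_) (fun {L} _ ih _ _ col F => ?_) L col F
  · have := Finite.of_equiv L' e.symm
    have := Fintype.ofFinite (L → ι)
    rw [← colorCount_comp_equiv e, ih, ← (e.arrowCongr (Equiv.refl ι)).sum_comp]
    refine Finset.sum_congr rfl fun c _ => Finset.prod_congr rfl fun i _ => ?_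
    rw [← colorCount_comp_equiv (e.subtypeEquiv (p := fun l => c l = i) fun l => by simp)]
    rfl
  · simp [colorCount_of_isEmpty, egfCoeff, coeff_zero_eq_constantCoeff]
  · have := Fintype.ofFinite (L → ι)
    exact egfCoeff_prod_option col F (ih _)

end ProductFormula

namespace HypergraphSeries

open MultiHypergraph MvPowerSeries

section LabelColor

variable {V E : Type*} (k : E → EdgeSize)

/-- The indeterminate marking a vertex or an edge of a hypergraph whose edges have sizes `k`. -/
def labelColor : V ⊕ E → Option EdgeSize :=
  Sum.elim (fun _ => none) fun e => some (k e)

variable [Finite V] [Finite E]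

theorem colorCount_labelColor_none :
    colorCount (labelColor (V := V) k) none = Nat.card V :=
  Nat.card_congr
    { toFun := fun
        | ⟨.inl v, _⟩ => v
      invFun := fun v => ⟨.inl v, rfl⟩
      left_inv := by rintro ⟨v | e, h⟩; exacts [rfl, nomatch h]
      right_inv := fun _ => rfl }

theorem colorCount_labelColor_some (j : EdgeSize) :
    colorCount (labelColor (V := V) k) (some j) = Nat.card {e // k e = j} := by
  have h : IsEmpty {v : V // labelColor k (.inl v : V ⊕ E) = some j} := ⟨fun v => nomatch v.2⟩
  rw [colorCount_apply, Nat.card_congr Equiv.subtypeSum, Nat.card_sum, Nat.card_of_isEmpty,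
    zero_add]
  exact Nat.card_congr (Equiv.subtypeEquivRight fun e => Option.some_inj)

theorem colorCount_labelColor_option (j : EdgeSize) :
    colorCount (labelColor (V := V) fun e : Option E => e.elim j k) =
      colorCount (labelColor (V := V) k) + Finsupp.single (some j) 1 := by
  have := Fintype.ofFinite V
  have := Fintype.ofFinite E
  simp only [colorCount_eq_sum, labelColor, Fintype.sum_sum_type, Fintype.sum_option,
    Sum.elim_inl, Sum.elim_inr, Option.elim_none, Option.elim_some]
  abel

theorem colorCount_labelColor_fiber {ι : Type*} (c : V ⊕ E → ι) (i : ι) :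
    colorCount (fun l : {l // c l = i} => labelColor k (l : V ⊕ E)) =
      colorCount
        (labelColor (V := {v // c (.inl v) = i}) fun e : {e // c (.inr e) = i} => k e) := by
  rw [← colorCount_comp_equiv Equiv.subtypeSum.symm]
  congr 1
  funext l
  cases l <;> rfl

end LabelColor

theorem card_edgeLabel_fiber (lam : EdgeSize →₀ ℕ) (j : EdgeSize) :
    Nat.card {e : EdgeLabel lam // e.1 = j} = lam j := by
  rw [Nat.card_congr (Equiv.sigmaSubtype j), Nat.card_fin]

theorem colorCount_edgeLabel (d : Option EdgeSize →₀ ℕ) :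
    colorCount (labelColor (V := Fin (d none)) fun e : EdgeLabel d.some => e.1) = d := by
  ext (_ | j)
  · rw [colorCount_labelColor_none, Nat.card_fin]
  · rw [colorCount_labelColor_some, card_edgeLabel_fiber, Finsupp.some_apply]

theorem egfCoeff_hypertreeEGF (d : Option EdgeSize →₀ ℕ) :
    egfCoeff d hypertreeEGF =
      Nat.card (SizedHypertree (Fin (d none)) fun e : EdgeLabel d.some => e.1) := by
  change _ * (if d none = 0 then 0 else _) = _
  split_ifs with h
  · have : IsEmpty (Fin (d none)) := h ▸ Fin.isEmpty
    have : IsEmpty (SizedHypertree (Fin (d none)) fun e : EdgeLabel d.some => e.1) :=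
      ⟨fun H => (isTree_incGraph_iff.1 H.2.2).1.elim isEmptyElim⟩
    rw [mul_zero, Nat.card_of_isEmpty, Nat.cast_zero]
  · have : Nonempty (Fin (d none)) := ⟨⟨0, Nat.pos_of_ne_zero h⟩⟩
    have cast_prod : ((d.prod fun _ k => k ! : ℕ) : ℚ) =
        (d none)! * d.some.prod fun _ k => (k ! : ℚ) := by
      rw [prod_factorial_option, Nat.cast_mul, Nat.cast_finsuppProd]
    rw [← cast_prod, mul_div_cancel₀ _ (prod_factorial_cast_ne_zero d), hypertreeCount]
    simp only [SizedHypertree, isTree_incGraph_iff, this, true_and]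

theorem egfCoeff_colorCount_hypertreeEGF {V E : Type*} [Finite V] [Finite E] (k : E → EdgeSize) :
    egfCoeff (colorCount (labelColor (V := V) k)) hypertreeEGF =
      Nat.card (SizedHypertree V fun e => (k e : ℕ)) := by
  rw [egfCoeff_hypertreeEGF, Nat.cast_inj, eq_comm]
  exact card_sizedHypertree_congr (Finite.equivFinOfCardEq (colorCount_labelColor_none k).symm)
    ((Equiv.sigmaFiberEquiv k).symm.trans <| Equiv.sigmaCongrRight fun j =>
      Finite.equivFinOfCardEq (colorCount_labelColor_some (V := V) k j).symm) fun _ => rfl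

/-- The series `R = t ∂T/∂t`, which counts hypertrees with a distinguished vertex. -/
noncomputable def rootedHypertreeEGF : HypergraphSeries :=
  t * dt hypertreeEGF

theorem egfCoeff_colorCount_rootedHypertreeEGF {V E : Type*} [Finite V] [Finite E]
    (k : E → EdgeSize) :
    egfCoeff (colorCount (labelColor (V := V) k)) rootedHypertreeEGF =
      Nat.card V * Nat.card (SizedHypertree V fun e => (k e : ℕ)) := by
  rw [rootedHypertreeEGF, t, dt, egfCoeff_X_mul_pderiv, colorCount_labelColor_none,
    egfCoeff_colorCount_hypertreeEGF]

theorem egfCoeff_colorCount_rootedHypertreeEGF_pow {V E : Type*} [Finite V] [Finite E]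
    (k : E → EdgeSize) (j : EdgeSize) :
    egfCoeff (colorCount (labelColor (V := V) k)) (rootedHypertreeEGF ^ (j : ℕ)) =
      (j : ℕ)! * egfCoeff (colorCount (labelColor (V := V) k) + Finsupp.single (some j) 1)
        hypertreeEGF := by
  have := Fintype.ofFinite (V ⊕ E → Fin j)
  have card_fiber_sum := sum_prod_card_rooted (ι := Fin j) (V := V)
    (s := fun e : Option E => ((e.elim j k : EdgeSize) : ℕ)) (by simpa using j.2) (by simp)
  rw [Fintype.card_fin, mul_comm] at card_fiber_sum
  rw [← Fin.prod_const, egfCoeff_prod, ← colorCount_labelColor_option,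
    egfCoeff_colorCount_hypertreeEGF]
  simp_rw [colorCount_labelColor_fiber, egfCoeff_colorCount_rootedHypertreeEGF]
  exact_mod_cast card_fiber_sum

theorem rootedHypertreeEGF_pow (j : EdgeSize) :
    rootedHypertreeEGF ^ (j : ℕ) = ((j : ℕ)! : ℚ) • pderiv ℚ (some j) hypertreeEGF := by
  refine ext_egfCoeff fun d => ?_
  have egfCoeff_pow := egfCoeff_colorCount_rootedHypertreeEGF_pow (V := Fin (d none))
    (fun e : EdgeLabel d.some => e.1) j
  rw [colorCount_edgeLabel] at egfCoeff_pow
  rw [egfCoeff_pow, egfCoeff_add_single, egfCoeff, egfCoeff, coeff_smul, mul_left_comm]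

theorem sum_edgeLabel {M : Type*} [AddCommMonoid M] (lam : EdgeSize →₀ ℕ)
    [Fintype (EdgeLabel lam)] (f : EdgeSize → M) :
    ∑ e : EdgeLabel lam, f e.1 = ∑ j ∈ lam.support, lam j • f j := by
  classical
  have maps_to (e : EdgeLabel lam) : e.1 ∈ lam.support :=
    Finsupp.mem_support_iff.2 fun h => (Fin.cast h e.2).elim0
  rw [← Finset.sum_fiberwise_of_maps_to fun e _ => maps_to e]
  refine Finset.sum_congr rfl fun j _ => ?_
  rw [Finset.sum_congr rfl fun e he => congrArg f (Finset.mem_filter.1 he).2, Finset.sum_const,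
    ← Fintype.card_subtype, ← Nat.card_eq_fintype_card, card_edgeLabel_fiber]

theorem exists_sizedHypertree_of_coeff_ne_zero {d : Option EdgeSize →₀ ℕ}
    (hd : coeff d hypertreeEGF ≠ 0) :
    Nonempty (SizedHypertree (Fin (d none)) fun e : EdgeLabel d.some => e.1) := by
  refine (Nat.card_ne_zero.1 ?_).1
  rw [← Nat.cast_ne_zero (R := ℚ), ← egfCoeff_hypertreeEGF]
  exact mul_ne_zero (prod_factorial_cast_ne_zero d) hd

theorem sum_size_sub_one_add_one {d : Option EdgeSize →₀ ℕ} (hd : coeff d hypertreeEGF ≠ 0) :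
    ∑ j ∈ d.some.support, ((j : ℕ) - 1 : ℚ) * d (some j) + 1 = d none := by
  have := Fintype.ofFinite (EdgeLabel d.some)
  obtain ⟨H, card_ends, isTree⟩ := exists_sizedHypertree_of_coeff_ne_zero hd
  have card_eq : (∑ e : EdgeLabel d.some, ((e.1 : ℕ) : ℚ)) + 1 =
      d none + ∑ _e : EdgeLabel d.some, 1 := by
    have := sum_card_ends_add_one isTree
    simp only [card_ends, Fintype.card_fin] at this
    rw [Finset.sum_const, Finset.card_univ, nsmul_one]
    exact_mod_cast this
  have sum_sizes := sum_edgeLabel d.some fun j => ((j : ℕ) - 1 : ℚ)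
  simp only [Finset.sum_sub_distrib, nsmul_eq_mul, mul_comm (Nat.cast _ : ℚ),
    Finsupp.some_apply] at sum_sizes
  linarith

/-- The series `(j - 1) u_j R ^ j / j!`. -/
noncomputable def edgeTerm (j : EdgeSize) : HypergraphSeries :=
  (((j : ℕ) : ℚ) - 1) • u j * ((1 / ((j : ℕ)! : ℚ)) • rootedHypertreeEGF ^ (j : ℕ))

theorem coeff_edgeTerm (j : EdgeSize) (d : Option EdgeSize →₀ ℕ) :
    coeff d (edgeTerm j) = ((j : ℕ) - 1 : ℚ) * d (some j) * coeff d hypertreeEGF := by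
  have factorial_ne_zero : ((j : ℕ)! : ℚ) ≠ 0 := by positivity
  rw [edgeTerm, rootedHypertreeEGF_pow, smul_smul, one_div_mul_cancel factorial_ne_zero, one_smul,
    smul_mul_assoc, coeff_smul, u, coeff_X_mul_pderiv, mul_assoc]

theorem coeff_rootedHypertreeEGF_sub (d : Option EdgeSize →₀ ℕ) :
    coeff d (rootedHypertreeEGF - hypertreeEGF) =
      ∑ j ∈ d.some.support, coeff d (edgeTerm j) := by
  simp_rw [coeff_edgeTerm]
  rw [map_sub, rootedHypertreeEGF, t, dt, coeff_X_mul_pderiv, ← Finset.sum_mul]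
  obtain hd | hd := eq_or_ne (coeff d hypertreeEGF) 0
  · simp [hd]
  · rw [← sum_size_sub_one_add_one hd]
    ring

theorem hasSum_edgeTerm [TopologicalSpace ℚ] :
    HasSum edgeTerm (rootedHypertreeEGF - hypertreeEGF) := by
  refine MvPowerSeries.WithPiTopology.hasSum_iff_hasSum_coeff.2 fun d => ?_
  rw [coeff_rootedHypertreeEGF_sub]
  refine hasSum_sum_of_ne_finset_zero fun j hj => ?_
  rw [coeff_edgeTerm, show d (some j) = 0 by simpa using hj, Nat.cast_zero, mul_zero, zero_mul]

end HypergraphSeries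

/-- The infinite sum is taken in the ring of formal power series with the topology of
coefficientwise convergence, the coefficient field being discrete. -/
theorem mainTheorem5 :
    letI : TopologicalSpace ℚ := ⊥
    let T : HypergraphSeries := HypergraphSeries.hypertreeEGF
    let R : HypergraphSeries := HypergraphSeries.t * HypergraphSeries.dt T
    let term : EdgeSize → HypergraphSeries := fun j =>
      (((j : ℕ) : ℚ) - 1) • HypergraphSeries.u j * ((1 / ((j : ℕ)! : ℚ)) • R ^ (j : ℕ))
    Summable term ∧ T = R - ∑' j : EdgeSize, term j := by
  let _ : TopologicalSpace ℚ := ⊥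
  intro T R term
  have : DiscreteTopology ℚ := ⟨rfl⟩
  have hasSum_term : HasSum term (R - T) := HypergraphSeries.hasSum_edgeTerm
  exact ⟨hasSum_term.summable, by rw [hasSum_term.tsum_eq, sub_sub_cancel]⟩
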